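/- **Jacobian of the geodesic polar transformation.** Let $m\ge 1$, let $\rho,\nu:\mathbb R^m\to(0,\infty)$ be smooth, put $c=\sqrt{\nu/\rho}$, and let $x_0\in\mathbb R^m$ be a source point; write $\rho_0=\rho(x_0)$, $c_0=c(x_0)$. The ray with take-off angle $\omega\in\mathbb S^{m-1}$ is the solution $(x(t),p(t))$ of the Hamiltonian system with $H(x,p)=c(x)|p|$, $$\dot x=c(x)\frac{p}{|p|},\qquad \dot p=-|p|\,\nabla c(x),\qquad x(0)=x_0,\quad p(0)=\frac{\omega}{c_0}.$$ Let $T>0$ be such that the rays from $x_0$ exist for $0\le t<T$ and are free of caustics there: the ray map $X(t\omega)=x(t)$ is well defined, smooth and one-to-one on the ball $\{y\in\mathbb R^m:|y|<T\}$, with everywhere invertible derivative. Let $U$ be the image of this ball, and for $x=X(t\omega)\in U\setminus\{x_0\}$ let $\tau(x)=t$ (traveltime) and $\omega(x)=\omega$ (take-off angle) be the geodesic polar coordinates of $x$, with $\tau(x_0)=0$. Let $$J(x)=\Big|\frac{\partial S}{\partial\omega}\Big|$$ be the area element of the wavefront $\tau=\mathrm{const}$ per unit solid angle at the source, i.e.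 the Jacobian $\sqrt{\det(A^{T}A)}$ with $A$ the derivative at $\omega(x)$ of the map $\mathbb S^{m-1}\ni\omega\mapsto X(t\omega)$, $t=\tau(x)$. Let $v_0$ be the leading Hadamard coefficient, i.e. $v_0$ is differentiable in $U\setminus\{x_0\}$ and solves there the transport equation $$4\nu\tau\,\nabla\tau\cdot\nabla v_0+\big[\nabla\cdot(\nu\nabla\tau^2)\big]v_0-2m\rho\,v_0=0,$$ and it is continuous at $x_0$ with $$v_0(x_0)=\frac{1}{2\rho_0c_0^m\pi^{(m-1)/2}}.$$ Then at every point of $U\setminus\{x_0\}$ one has $v_0\ne0$ and $$\Big|\frac{\partial S}{\partial\omega}\Big|=\frac{\tau^{m-1}}{4\rho_0c_0^m\pi^{m-1}\,\rho\,c\,v_0^2},$$ and the field $cJ^{-1}\nabla\tau$ is differentiable with $\nabla\cdot(cJ^{-1}\nabla\tau)=0$. -/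

import Mathlib

noncomputable section

namespace Hadamard

/-- Physical space `ℝᵐ` with its Euclidean structure. -/
abbrev Space (m : ℕ) : Type := EuclideanSpace ℝ (Fin m)

variable {m : ℕ}

/-- The divergence `∇ · F` of a vector field, i.e. the trace of its derivative. -/
def divergence (F : Space m → Space m) (x : Space m) : ℝ :=
  LinearMap.trace ℝ (Space m) (fderiv ℝ F x : Space m →ₗ[ℝ] Space m)

/-- The wave speed `c = √(ν / ρ)` of the medium. -/
def waveSpeed (ρ ν : Space m → ℝ) (x : Space m) : ℝ := Real.sqrt (ν x / ρ x)

/-- `(x, p)` is the bicharacteristic of the Hamiltonian `H(x, p) = c(x) |p|` on `[0, T)` issuing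
from the source `x₀` with take-off angle `ω`:
`x' = ∇ₚH = c(x) p / |p|`, `p' = -∇ₓH = -|p| ∇c(x)`, `x(0) = x₀`, `p(0) = ω / c(x₀)`. -/
structure IsRay (c : Space m → ℝ) (x₀ ω : Space m) (T : ℝ) (x p : ℝ → Space m) : Prop where
  position_zero : x 0 = x₀
  slowness_zero : p 0 = (c x₀)⁻¹ • ω
  deriv_position : ∀ t ∈ Set.Ico 0 T,
    HasDerivWithinAt x ((c (x t) / ‖p t‖) • p t) (Set.Ico 0 T) t
  deriv_slowness : ∀ t ∈ Set.Ico 0 T,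
    HasDerivWithinAt p (-(‖p t‖ • gradient c (x t))) (Set.Ico 0 T) t

/-- The ball of traveltime radius `T` about the source `x₀` is free of caustics (other than the
source), and `X` is its ray map: `X (t • ω)` is the position at time `t` of the ray with take-off
angle `ω`. The rays exist up to time `T`, a point is reached by only one ray,
the position is a smooth function of `y = t • ω`, and there are no conjugate points, that is, the
ray map is nowhere singular. -/
structure CausticFree (c : Space m → ℝ) (x₀ : Space m) (T : ℝ) (X : Space m → Space m) :
    Prop where
  time_pos : 0 < T
  isRay : ∀ ω : Space m, ‖ω‖ = 1 → ∃ p : ℝ → Space m, IsRay c x₀ ω T (fun t => X (t • ω)) p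
  smooth : ContDiffOn ℝ (⊤ : ℕ∞) X (Metric.ball 0 T)
  injOn : Set.InjOn X (Metric.ball 0 T)
  regular : ∀ y ∈ Metric.ball (0 : Space m) T, Function.Bijective (fderiv ℝ X y)

/-- The neighbourhood of the source swept out by the rays before time `T`. -/
def rayNeighbourhood (X : Space m → Space m) (T : ℝ) : Set (Space m) := X '' Metric.ball 0 T

/-- The point `y = τ • ω` belonging to the point `x` of the ray neighbourhood. -/
def rayPreimage (X : Space m → Space m) (T : ℝ) (x : Space m) : Space m :=
  Function.invFunOn X (Metric.ball 0 T) x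

/-- First component of the geodesic polar transformation `x ↦ (τ, ω)`: the traveltime `τ(x)`
from the source to `x` along the ray joining them. -/
def travelTime (X : Space m → Space m) (T : ℝ) (x : Space m) : ℝ := ‖rayPreimage X T x‖

/-- Second component of the geodesic polar transformation `x ↦ (τ, ω)`: the take-off angle
`ω(x)` of the ray joining the source to `x`. -/
def takeOffAngle (X : Space m → Space m) (T : ℝ) (x : Space m) : Space m :=
  (travelTime X T x)⁻¹ • rayPreimage X T x

/-- The area element `√ det (Lᵀ L)` of a linear map `L`, that is, the factor by which it
multiplies volumes of the dimension of its domain. -/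
def areaFactor {F E : Type*} [NormedAddCommGroup F] [InnerProductSpace ℝ F]
    [FiniteDimensional ℝ F] [NormedAddCommGroup E] [InnerProductSpace ℝ E]
    [FiniteDimensional ℝ E] (L : F →ₗ[ℝ] E) : ℝ :=
  Real.sqrt (LinearMap.det (LinearMap.adjoint L ∘ₗ L))

/-- `|∂S/∂ω|` at `(t, ω)`: the area cut out on the wavefront `τ = t` by the rays, per unit solid
angle at the source. It is the area factor of the derivative at `ω` of the wavefront
parametrization `ω ↦ X (t • ω)`, restricted to the tangent space `ω^⊥` of the unit sphere. -/
def wavefrontJacobian (X : Space m → Space m) (t : ℝ) (ω : Space m) : ℝ :=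
  areaFactor ((fderiv ℝ (fun z => X (t • z)) ω : Space m →ₗ[ℝ] Space m) ∘ₗ
    (Submodule.span ℝ {ω})ᗮ.subtype)

/-- `|∂S/∂ω|` as a function of the position `x`, through the geodesic polar transformation. -/
def wavefrontJacobianAt (X : Space m → Space m) (T : ℝ) (x : Space m) : ℝ :=
  wavefrontJacobian X (travelTime X T x) (takeOffAngle X T x)

/-- `v₀` is the leading Hadamard coefficient in the neighbourhood `U` of `x₀`, for the phase `τ`:
the solution of the transport equation
`4 ν τ ∇τ · ∇v₀ + [∇ · (ν ∇τ²)] v₀ - 2 m ρ v₀ = 0` away from the source, continuous at the source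
with the value `1 / (2 ρ₀ c₀ᵐ π^((m-1)/2))`. -/
structure IsLeadingCoefficient (ρ ν : Space m → ℝ) (x₀ : Space m) (U : Set (Space m))
    (τ v₀ : Space m → ℝ) : Prop where
  source_value :
    v₀ x₀ = 1 / (2 * ρ x₀ * waveSpeed ρ ν x₀ ^ m * Real.pi ^ (((m : ℝ) - 1) / 2))
  continuousAt : ContinuousAt v₀ x₀
  differentiableAt : ∀ x ∈ U \ {x₀}, DifferentiableAt ℝ v₀ x
  transport : ∀ x ∈ U \ {x₀},
    4 * ν x * τ x * inner ℝ (gradient τ x) (gradient v₀ x)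
      + divergence (fun z => ν z • gradient (fun w => τ w ^ 2) z) x * v₀ x
      - 2 * m * ρ x * v₀ x = 0

end Hadamard

end

/-!
The ray map `X` is used as a coordinate system: every field on the ray neighbourhood is pulled back
to the ball of the points `y = τ ω`, where differentiation along a ray becomes differentiation
along the radius. Write `d = det DX`.

* Along a ray `c |p| = 1`, so the slowness is determined by the ray map through `c² p = x'`, and
  `|DX(y) y|² = c² |y|²` (`CausticFree.norm_fderiv_self_sq`). Differentiating this identity and
  integrating along the ray gives the Gauss lemma `⟨DX(y) y, DX(y) h⟩ = c² ⟨y, h⟩`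
  (`CausticFree.inner_fderiv_self`).
* The Gauss lemma says that `τ ∇τ = c⁻² DX(y) y`, and that `DXᵀ DX` is block diagonal with respect to
  the radial direction and its complement, so that `J = τᵐ⁻¹ |d| / c`
  (`CausticFree.wavefrontJacobianAt_map`).
* Both divergences of the theorem are of fields whose pullback is radial, `G ∘ X = φ • DX(y) y`. For
  these `divergence_pushforward_radial` gives `d · ∇·G = ∇_y · (d φ y)`, by the symmetry of the second
  derivative of `X` and Jacobi's formula for the derivative of a determinant.
* With `φ = 2 ρ`, for which `G = ν ∇τ²`, the transport equation becomes the conservation law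
  `∂(ρ v₀² d) = 0` along each ray. As `v₀` is continuous at the source, where `DX = c₀ · id`, this
  yields `ρ v₀² d = ρ₀ c₀ᵐ v₀(x₀)² = 1 / (4 ρ₀ c₀ᵐ πᵐ⁻¹)`
  (`IsLeadingCoefficient.four_mul_mul_det_mul_sq`). In particular `v₀ ≠ 0` and `d > 0`, and the
  formula for `J` follows.
* With `φ = |y|⁻ᵐ d⁻¹`, for which `G = c J⁻¹ ∇τ`, the divergence is `d⁻¹ ∇_y · (|y|⁻ᵐ y) = 0`.
-/

namespace Hadamard

open Filter Topology

/-! ### Determinants and divergences -/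

lemma eq_of_hasDerivAt_zero {f : ℝ → ℝ} {a b : ℝ} (hab : a ≤ b)
    (hf : ContinuousOn f (Set.Icc a b)) (hf' : ∀ t ∈ Set.Ioo a b, HasDerivAt f 0 t) :
    f b = f a := by
  rcases hab.eq_or_lt with rfl | hab
  · rfl
  obtain ⟨t, -, ht⟩ := exists_hasDerivAt_eq_slope f 0 hab hf hf'
  have : b - a ≠ 0 := (sub_pos.2 hab).ne'
  simp only [Pi.zero_apply] at ht
  field_simp at ht
  linarith

section Calculus

variable {E F : Type*} [NormedAddCommGroup E] [NormedSpace ℝ E] [FiniteDimensional ℝ E]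
  [NormedAddCommGroup F] [NormedSpace ℝ F]

/-- If `X` is a local diffeomorphism at `y`, a field `G` is differentiable at `X y` as soon as its
pullback `H` by `X` is differentiable at `y`. -/
lemma hasFDerivAt_of_comp_localDiffeo {X : E → E} {e : E ≃L[ℝ] E} {y : E}
    (hX : HasStrictFDerivAt X (e : E →L[ℝ] E) y) {G H : E → F} {H' : E →L[ℝ] F}
    (hGH : ∀ᶠ z in 𝓝 y, G (X z) = H z) (hH : HasFDerivAt H H' y) :
    HasFDerivAt G (H'.comp (e.symm : E →L[ℝ] E)) (X y) := by
  have := FiniteDimensional.complete ℝ E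
  have h1 : HasFDerivAt (fun x => H (hX.localInverse X e y x))
      (H'.comp (e.symm : E →L[ℝ] E)) (X y) := by
    refine HasFDerivAt.comp (X y) (g := H) ?_ hX.to_localInverse.hasFDerivAt
    rwa [hX.localInverse_apply_image]
  refine h1.congr_of_eventuallyEq ?_
  filter_upwards [hX.eventually_right_inverse, hX.localInverse_tendsto.eventually hGH] with x h h'
  rw [← h', h]

lemma differentiable_continuousLinearMap_det :
    Differentiable ℝ (fun A : E →L[ℝ] E => A.det) := by
  let b := Module.finBasis ℝ E
  have h : (fun A : E →L[ℝ] E => A.det) = fun A : E →L[ℝ] E =>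
      (LinearMap.toMatrix b b (A : E →ₗ[ℝ] E)).det := by
    funext A
    rw [LinearMap.det_toMatrix]
  rw [h]
  simp only [Matrix.det_apply]
  refine Differentiable.fun_sum fun σ _ => Differentiable.const_smul ?_ _
  suffices h : ∀ i, Differentiable ℝ (fun A : E →L[ℝ] E =>
      LinearMap.toMatrix b b (A : E →ₗ[ℝ] E) (σ i) i) by fun_prop
  intro i
  let l : (E →L[ℝ] E) →ₗ[ℝ] ℝ :=
    { toFun := fun A => LinearMap.toMatrix b b (A : E →ₗ[ℝ] E) (σ i) i
      map_add' := by intros; simp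
      map_smul' := by intros; simp }
  exact (LinearMap.toContinuousLinearMap l).differentiable

lemma hasDerivAt_det_one_add_smul (M : E →L[ℝ] E) :
    HasDerivAt (fun r : ℝ => (1 + r • M).det) (LinearMap.trace ℝ E M) 0 := by
  let b := Module.finBasis ℝ E
  let N := LinearMap.toMatrix b b (M : E →ₗ[ℝ] E)
  have h : (fun r : ℝ => (1 + r • M).det) = fun r : ℝ => (1 : ℝ) + N.trace * r +
      ((1 + (Polynomial.X : Polynomial ℝ) • N.map Polynomial.C).det).divX.divX.eval r * r ^ 2 := by
    funext r
    rw [← Matrix.det_one_add_smul]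
    change LinearMap.det _ = _
    rw [← LinearMap.det_toMatrix b]
    congr 1
    simp [N, LinearMap.toMatrix_one]
  rw [h, LinearMap.trace_eq_matrix_trace ℝ b]
  set P := ((1 + (Polynomial.X : Polynomial ℝ) • N.map Polynomial.C).det).divX.divX
  have := (((hasDerivAt_id (0 : ℝ)).const_mul N.trace).const_add 1).add
    ((P.hasDerivAt 0).mul (hasDerivAt_pow 2 (0 : ℝ)))
  convert! this using 1
  simp [N]

/-- Jacobi's formula for the derivative of the determinant at an invertible operator. -/
lemma fderiv_det_apply (e : E ≃L[ℝ] E) (M : E →L[ℝ] E) :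
    fderiv ℝ (fun A : E →L[ℝ] E => A.det) (e : E →L[ℝ] E) M =
      (e : E →L[ℝ] E).det * LinearMap.trace ℝ E ((e.symm : E →L[ℝ] E).comp M) := by
  have h1 : HasDerivAt (fun r : ℝ => ((e : E →L[ℝ] E) + r • M).det)
      (fderiv ℝ (fun A : E →L[ℝ] E => A.det) (e : E →L[ℝ] E) M) 0 := by
    have h2 : HasDerivAt (fun r : ℝ => (e : E →L[ℝ] E) + r • M) M 0 := by
      simpa using ((hasDerivAt_id (0 : ℝ)).smul_const M).const_add (e : E →L[ℝ] E)
    have h3 := (differentiable_continuousLinearMap_det (E := E) (e : E →L[ℝ] E)).hasFDerivAt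
    refine HasFDerivAt.comp_hasDerivAt (0 : ℝ) (l := fun A : E →L[ℝ] E => A.det) ?_ h2
    simpa using h3
  refine h1.unique ?_
  refine ((hasDerivAt_det_one_add_smul ((e.symm : E →L[ℝ] E).comp M)).const_mul
    (e : E →L[ℝ] E).det).congr_of_eventuallyEq (Eventually.of_forall fun r => ?_)
  change LinearMap.det _ = LinearMap.det _ * LinearMap.det _
  rw [← LinearMap.det_comp]
  congr 1
  ext v
  simp

lemma exists_continuousLinearEquiv_of_bijective {A : E →L[ℝ] E} (hA : Function.Bijective A) :
    ∃ e : E ≃L[ℝ] E, (e : E →L[ℝ] E) = A :=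
  ⟨(LinearEquiv.ofBijective (A : E →ₗ[ℝ] E) hA).toContinuousLinearEquiv, by ext; rfl⟩

end Calculus

/-- The Piola identity for the field which is pulled back by `X` to the
radial field `z ↦ φ z • z`: `det DX · div G = div (det DX · φ · z)`. -/
lemma divergence_pushforward_radial {m : ℕ} {X G : Space m → Space m} {φ : Space m → ℝ}
    {y : Space m} (hX : ContDiffAt ℝ 2 X y) (hreg : Function.Bijective (fderiv ℝ X y))
    (hφ : DifferentiableAt ℝ φ y)
    (hG : ∀ᶠ z in 𝓝 y, G (X z) = φ z • fderiv ℝ X z z) :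
    DifferentiableAt ℝ G (X y) ∧
    (fderiv ℝ X y).det * divergence G (X y) =
      (fderiv ℝ X y).det * fderiv ℝ φ y y
        + φ y * (fderiv ℝ (fun z => (fderiv ℝ X z).det) y y + m * (fderiv ℝ X y).det) := by
  obtain ⟨e, he⟩ := exists_continuousLinearEquiv_of_bijective hreg
  have hs : HasStrictFDerivAt X (e : Space m →L[ℝ] Space m) y := by
    rw [he]; exact hX.hasStrictFDerivAt two_ne_zero
  have hA : DifferentiableAt ℝ (fderiv ℝ X) y :=
    (hX.fderiv_right (m := 1) (by norm_num)).differentiableAt one_ne_zero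
  have hsymm : IsSymmSndFDerivAt ℝ X y := hX.isSymmSndFDerivAt (by simp)
  have hH := hφ.hasFDerivAt.smul (hA.hasFDerivAt.clm_apply (hasFDerivAt_id y))
  have hG' := hasFDerivAt_of_comp_localDiffeo hs hG hH
  refine ⟨hG'.differentiableAt, ?_⟩
  have hdet : fderiv ℝ (fun z => (fderiv ℝ X z).det) y y = (fderiv ℝ X y).det *
      LinearMap.trace ℝ (Space m)
        ((e.symm : Space m →L[ℝ] Space m).comp (fderiv ℝ (fderiv ℝ X) y y)) := by
    have h1 : HasFDerivAt (fun z => (fderiv ℝ X z).det) _ y :=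
      HasFDerivAt.comp y (g := fun A : Space m →L[ℝ] Space m => A.det)
        (differentiable_continuousLinearMap_det _).hasFDerivAt hA.hasFDerivAt
    rw [h1.fderiv, ContinuousLinearMap.comp_apply, ← he, fderiv_det_apply, he]
  have htr : divergence G (X y) = φ y * (LinearMap.trace ℝ (Space m)
        ((e.symm : Space m →L[ℝ] Space m).comp (fderiv ℝ (fderiv ℝ X) y y)) + m)
        + fderiv ℝ φ y y := by
    rw [divergence, hG'.fderiv, ContinuousLinearMap.toLinearMap_comp, LinearMap.trace_comp_comm',
      ← ContinuousLinearMap.toLinearMap_comp]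
    have : (((e.symm : Space m →L[ℝ] Space m).comp (φ y • ((fderiv ℝ X y).comp
        (ContinuousLinearMap.id ℝ (Space m)) + (fderiv ℝ (fderiv ℝ X) y).flip (id y)) +
        (fderiv ℝ φ y).smulRight (fderiv ℝ X y (id y))) : Space m →L[ℝ] Space m) :
          Space m →ₗ[ℝ] Space m) =
        φ y • ((((e.symm : Space m →L[ℝ] Space m).comp (fderiv ℝ (fderiv ℝ X) y y)
            : Space m →L[ℝ] Space m) : Space m →ₗ[ℝ] Space m) + LinearMap.id)
          + (fderiv ℝ φ y : Space m →ₗ[ℝ] ℝ).smulRight y := by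
      ext1 v
      simp [← he, hsymm v y, add_comm]
    rw [this]
    simp [LinearMap.trace_smulRight, mul_add]
  rw [htr, hdet]
  ring

/-! ### Area factors -/

lemma areaFactor_eq_normDet {F E : Type*} [NormedAddCommGroup F] [InnerProductSpace ℝ F]
    [FiniteDimensional ℝ F] [NormedAddCommGroup E] [InnerProductSpace ℝ E]
    [FiniteDimensional ℝ E] (L : F →ₗ[ℝ] E) : areaFactor L = L.normDet := by
  rw [areaFactor, ← LinearMap.normDet_sq]
  exact Real.sqrt_sq L.normDet_nonneg

/-- If `M` maps the line of the unit vector `ω` and its orthogonal complement to orthogonal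
subspaces and stretches `ω` by the factor `k`, the volume factor of `M` is `k` times the area factor
of its restriction to the complement. -/
lemma normDet_eq_norm_mul_normDet_orthogonal {E : Type*} [NormedAddCommGroup E]
    [InnerProductSpace ℝ E] [FiniteDimensional ℝ E] (M : E →ₗ[ℝ] E) {ω : E} (hω : ‖ω‖ = 1) {k : ℝ}
    (hM : ∀ h, inner ℝ (M ω) (M h) = k ^ 2 * inner ℝ ω h) (hk : 0 ≤ k) :
    M.normDet = k * (M ∘ₗ (Submodule.span ℝ {ω})ᗮ.subtype).normDet := by
  set K := Submodule.span ℝ {ω}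
  set N := M ∘ₗ Kᗮ.subtype
  have hc : IsCompl K Kᗮ := Submodule.isCompl_orthogonal K
  let e := Submodule.prodEquivOfIsCompl K Kᗮ hc
  have hMK : ∀ u ∈ K, ∀ h, inner ℝ (M u) (M h) = k ^ 2 * inner ℝ u h := by
    intro u hu h
    obtain ⟨s, rfl⟩ := Submodule.mem_span_singleton.1 hu
    rw [map_smul, real_inner_smul_left, real_inner_smul_left, hM]
    ring
  -- `Mᵀ M` is block diagonal for the decomposition `E = K ⊕ Kᗮ`
  have hconj : (e : K × Kᗮ →ₗ[ℝ] E) ∘ₗ LinearMap.prodMap (k ^ 2 • LinearMap.id)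
      (LinearMap.adjoint N ∘ₗ N) ∘ₗ (e.symm : E →ₗ[ℝ] K × Kᗮ) = LinearMap.adjoint M ∘ₗ M := by
    ext1 x
    obtain ⟨⟨u, v⟩, rfl⟩ := e.surjective x
    refine ext_inner_right ℝ fun h => ?_
    obtain ⟨⟨a, b⟩, rfl⟩ := e.surjective h
    have h1 := hMK u u.2 a
    have h2 := hMK u u.2 b
    have h3 := hMK a a.2 v
    rw [real_inner_comm] at h3
    have h4 : inner ℝ (u : E) (b : E) = 0 := b.2 _ u.2
    have h5 : inner ℝ (a : E) (v : E) = 0 := v.2 _ a.2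
    have h6 : inner ℝ ((LinearMap.adjoint N (N v) : Kᗮ) : E) (a : E) = 0 := by
      rw [real_inner_comm]
      exact (LinearMap.adjoint N (N v)).2 _ a.2
    have h7 : inner ℝ ((LinearMap.adjoint N (N v) : Kᗮ) : E) (b : E) =
        inner ℝ (M (v : E)) (M (b : E)) := by
      rw [← Submodule.coe_inner, LinearMap.adjoint_inner_left]
      rfl
    simp only [LinearMap.comp_apply, LinearEquiv.coe_coe, LinearEquiv.symm_apply_apply]
    simp only [LinearMap.prodMap_apply, LinearMap.comp_apply (LinearMap.adjoint N) N, e,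
      Submodule.coe_prodEquivOfIsCompl', LinearMap.smul_apply,
      LinearMap.id_apply, LinearMap.adjoint_inner_left, map_add, inner_add_left, inner_add_right,
      Submodule.coe_smul, real_inner_smul_left, h1, h2, h3, h4, h5, h6, h7]
    ring
  have hfin : Module.finrank ℝ K = 1 := finrank_span_singleton (by rintro rfl; simp at hω)
  have h1 : M.normDet ^ 2 = (k * N.normDet) ^ 2 := by
    have h2 := LinearMap.normDet_sq M
    have h3 := LinearMap.normDet_sq N
    rw [mul_pow]
    simp only [RCLike.ofReal_real_eq_id, id] at h2 h3
    rw [h2, h3, ← hconj, LinearMap.det_conj, LinearMap.det_prodMap, LinearMap.det_smul, hfin]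
    simp
  exact (pow_left_inj₀ M.normDet_nonneg (mul_nonneg hk N.normDet_nonneg) two_ne_zero).1 h1

/-! ### Rays and the Gauss lemma -/

section Rays
variable {m : ℕ} {c : Space m → ℝ} {x₀ : Space m} {T : ℝ}

/-- The Hamiltonian `c |p|` is conserved along a ray. -/
lemma IsRay.speed_mul_norm_slowness {ω : Space m} {x p : ℝ → Space m}
    (h : IsRay c x₀ ω T x p) (hc : Differentiable ℝ c) (hpos : ∀ x, 0 < c x) (hω : ‖ω‖ = 1)
    {t : ℝ} (ht : t ∈ Set.Ico 0 T) : c (x t) * ‖p t‖ = 1 := by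
  have hderiv : ∀ s ∈ Set.Ico 0 T,
      HasDerivWithinAt (fun s => c (x s) ^ 2 * ‖p s‖ ^ 2) 0 (Set.Ico 0 T) s := by
    intro s hs
    have h1 : HasDerivWithinAt (fun s => c (x s)) _ (Set.Ico 0 T) s :=
      (hc (x s)).hasGradientAt.hasFDerivAt.comp_hasDerivWithinAt s (h.deriv_position s hs)
    have h2 := (h1.pow 2).mul (h.deriv_slowness s hs).norm_sq
    refine h2.congr_deriv ?_
    -- where `p` vanishes the right-hand sides of the ray equations are zero, `x / 0` being `0`
    rcases eq_or_ne (p s) 0 with h0 | h0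
    · simp [h0]
    have : ‖p s‖ ≠ 0 := norm_ne_zero_iff.2 h0
    simp only [InnerProductSpace.toDual_apply_apply, real_inner_smul_right, inner_neg_right,
      real_inner_comm (p s), Pi.pow_apply]
    field_simp
    ring
  have hsub : Set.Icc 0 t ⊆ Set.Ico 0 T := fun s hs => ⟨hs.1, hs.2.trans_lt ht.2⟩
  have h1 := eq_of_hasDerivAt_zero ht.1
    (fun s hs => ((hderiv s (hsub hs)).continuousWithinAt.mono hsub))
    (fun s hs => (hderiv s (hsub (Set.Ioo_subset_Icc_self hs))).hasDerivAt
      (Ico_mem_nhds hs.1 (hs.2.trans ht.2)))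
  have hc0 := hpos x₀
  simp only [h.position_zero, h.slowness_zero, norm_smul, hω, norm_inv, Real.norm_eq_abs,
    abs_of_pos hc0] at h1
  have h2 : (c (x t) * ‖p t‖) ^ 2 = 1 ^ 2 := by
    rw [mul_pow, h1]
    field_simp
  exact (pow_left_inj₀ (mul_nonneg (hpos _).le (norm_nonneg _)) zero_le_one two_ne_zero).1 h2

variable {X : Space m → Space m}

lemma CausticFree.contDiffAt (hX : CausticFree c x₀ T X) {y : Space m}
    (hy : y ∈ Metric.ball 0 T) : ContDiffAt ℝ 2 X y :=
  ((hX.smooth y hy).contDiffAt (Metric.isOpen_ball.mem_nhds hy)).of_le 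
    (WithTop.coe_le_coe.2 le_top : ((2 : ℕ∞) : WithTop ℕ∞) ≤ (⊤ : ℕ∞))

lemma CausticFree.hasFDerivAt (hX : CausticFree c x₀ T X) {y : Space m}
    (hy : y ∈ Metric.ball 0 T) : HasFDerivAt X (fderiv ℝ X y) y :=
  ((hX.contDiffAt hy).differentiableAt two_ne_zero).hasFDerivAt

lemma CausticFree.hasFDerivAt_fderiv (hX : CausticFree c x₀ T X) {y : Space m}
    (hy : y ∈ Metric.ball 0 T) : HasFDerivAt (fderiv ℝ X) (fderiv ℝ (fderiv ℝ X) y) y :=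
  (((hX.contDiffAt hy).fderiv_right (m := 1) (by norm_num)).differentiableAt
    one_ne_zero).hasFDerivAt

lemma smul_mem_ball_of_mem_Ico {ω : Space m} (hω : ‖ω‖ = 1) {t : ℝ} (ht : t ∈ Set.Ico 0 T) :
    t • ω ∈ Metric.ball (0 : Space m) T := by
  simpa [norm_smul, hω, abs_of_nonneg ht.1] using ht.2

/-- The hypothesis `1 ≤ m` provides a direction `ω` for the centre of the ball. -/
lemma exists_eq_smul_of_mem_ball (hm : 1 ≤ m) {y : Space m} (hy : y ∈ Metric.ball 0 T) :
    ∃ ω : Space m, ‖ω‖ = 1 ∧ y = ‖y‖ • ω ∧ ‖y‖ ∈ Set.Ico 0 T := by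
  have hy' : ‖y‖ ∈ Set.Ico 0 T := ⟨norm_nonneg y, by simpa using hy⟩
  rcases eq_or_ne y 0 with rfl | h0
  · exact ⟨EuclideanSpace.single ⟨0, hm⟩ 1, by simp, by simp, hy'⟩
  · have : ‖y‖ ≠ 0 := norm_ne_zero_iff.2 h0
    exact ⟨‖y‖⁻¹ • y, by simp [norm_smul, this], by simp [smul_smul, this], hy'⟩

lemma CausticFree.map_zero (hX : CausticFree c x₀ T X) (hm : 1 ≤ m) : X 0 = x₀ := by
  obtain ⟨p, hp⟩ := hX.isRay (EuclideanSpace.single ⟨0, hm⟩ 1) (by simp)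
  simpa using hp.position_zero

lemma CausticFree.hasDerivAt_ray (hX : CausticFree c x₀ T X) {ω : Space m} (hω : ‖ω‖ = 1) {t : ℝ}
    (ht : t ∈ Set.Ico 0 T) :
    HasDerivAt (fun t : ℝ => X (t • ω)) (fderiv ℝ X (t • ω) ω) t := by
  have h1 : HasDerivAt (fun t : ℝ => t • ω) ω t := by
    simpa using (hasDerivAt_id t).smul_const ω
  exact (hX.hasFDerivAt (smul_mem_ball_of_mem_Ico hω ht)).comp_hasDerivAt t h1

/-- The slowness vector is determined by the ray map: `c² p = x'`. -/
lemma CausticFree.fderiv_eq_smul_slowness (hX : CausticFree c x₀ T X) (hc : Differentiable ℝ c)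
    (hpos : ∀ x, 0 < c x) {ω : Space m} (hω : ‖ω‖ = 1) {p : ℝ → Space m}
    (hp : IsRay c x₀ ω T (fun t => X (t • ω)) p) {t : ℝ} (ht : t ∈ Set.Ico 0 T) :
    fderiv ℝ X (t • ω) ω = c (X (t • ω)) ^ 2 • p t := by
  have hT : (0 : ℝ) < T := ht.1.trans_lt ht.2
  have h1 := (uniqueDiffOn_Ico (0 : ℝ) T t ht).eq_deriv _ (hX.hasDerivAt_ray hω ht).hasDerivWithinAt
    (hp.deriv_position t ht)
  have h2 := hp.speed_mul_norm_slowness hc hpos hω ht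
  have h3 : ‖p t‖ ≠ 0 := by
    intro h
    simp [h] at h2
  rw [h1]
  congr 1
  field_simp
  linear_combination -c (X (t • ω)) * h2

/-- The eikonal equation in ray coordinates. -/
lemma CausticFree.norm_fderiv_self_sq (hX : CausticFree c x₀ T X) (hm : 1 ≤ m)
    (hc : Differentiable ℝ c) (hpos : ∀ x, 0 < c x) {y : Space m} (hy : y ∈ Metric.ball 0 T) :
    ‖fderiv ℝ X y y‖ ^ 2 = c (X y) ^ 2 * ‖y‖ ^ 2 := by
  obtain ⟨ω, hω, hyω, ht⟩ := exists_eq_smul_of_mem_ball hm hy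
  obtain ⟨p, hp⟩ := hX.isRay ω hω
  have h1 := hX.fderiv_eq_smul_slowness hc hpos hω hp ht
  have h2 := hp.speed_mul_norm_slowness hc hpos hω ht
  rw [← hyω] at h1
  beta_reduce at h2
  rw [← hyω] at h2
  have h3 : fderiv ℝ X y y = ‖y‖ • c (X y) ^ 2 • p ‖y‖ := by
    rw [← h1, ← map_smul, ← hyω]
  rw [h3, norm_smul, norm_smul, norm_pow, norm_norm, Real.norm_eq_abs, abs_of_pos (hpos _)]
  linear_combination (‖y‖ ^ 2 * c (X y) ^ 2) * (c (X y) * ‖p ‖y‖‖ + 1) * h2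

/-- To first order at the source, where `p = ω / c₀`, the ray map is `y ↦ x₀ + c₀ y`. -/
lemma CausticFree.fderiv_zero (hX : CausticFree c x₀ T X) (hm : 1 ≤ m)
    (hc : Differentiable ℝ c) (hpos : ∀ x, 0 < c x) :
    fderiv ℝ X 0 = c x₀ • ContinuousLinearMap.id ℝ (Space m) := by
  have key : ∀ ω : Space m, ‖ω‖ = 1 → fderiv ℝ X 0 ω = c x₀ • ω := by
    intro ω hω
    obtain ⟨p, hp⟩ := hX.isRay ω hω
    have h1 := hX.fderiv_eq_smul_slowness hc hpos hω hp ⟨le_rfl, hX.time_pos⟩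
    rw [zero_smul, hX.map_zero hm, hp.slowness_zero, smul_smul] at h1
    rw [h1]
    have := (hpos x₀).ne'
    congr 1
    field_simp
  ext1 y
  rcases eq_or_ne y 0 with rfl | h0
  · simp
  have h1 : ‖y‖ ≠ 0 := norm_ne_zero_iff.2 h0
  have h2 := key (‖y‖⁻¹ • y) (by simp [norm_smul, h1])
  rw [map_smul, smul_comm] at h2
  exact smul_right_injective _ (inv_ne_zero h1) h2

/-- The Gauss lemma: the rays are orthogonal to the wavefronts. -/
lemma CausticFree.inner_fderiv_self (hX : CausticFree c x₀ T X) (hm : 1 ≤ m)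
    (hc : Differentiable ℝ c) (hpos : ∀ x, 0 < c x) {y : Space m} (hy : y ∈ Metric.ball 0 T)
    (h : Space m) :
    inner ℝ (fderiv ℝ X y y) (fderiv ℝ X y h) = c (X y) ^ 2 * inner ℝ y h := by
  obtain ⟨ω, hω, hyω, hyT⟩ := exists_eq_smul_of_mem_ball hm hy
  obtain ⟨p, hp⟩ := hX.isRay ω hω
  -- `⟨p, t DX(t ω) h⟩ - t ⟨ω, h⟩` vanishes at the source and is constant along the ray
  have hderiv : ∀ t ∈ Set.Ico 0 T, HasDerivWithinAt
      (fun t => inner ℝ (p t) (t • fderiv ℝ X (t • ω) h) - t * inner ℝ ω h)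
      (inner ℝ (p t) (fderiv ℝ X (t • ω) h + t • fderiv ℝ (fderiv ℝ X) (t • ω) ω h)
        - t * (‖p t‖ * inner ℝ (gradient c (X (t • ω))) (fderiv ℝ X (t • ω) h))
        - inner ℝ ω h) (Set.Ico 0 T) t := by
    intro t ht
    have h1 : HasDerivAt (fun t : ℝ => t • ω) ω t := by
      simpa using (hasDerivAt_id t).smul_const ω
    have h2 : HasDerivAt (fun t : ℝ => fderiv ℝ X (t • ω) h)
        (fderiv ℝ (fderiv ℝ X) (t • ω) ω h) t := by
      have := (hX.hasFDerivAt_fderiv (smul_mem_ball_of_mem_Ico hω ht)).comp_hasDerivAt t h1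
      simpa using this.clm_apply (hasDerivAt_const t h)
    have h3 := ((hp.deriv_slowness t ht).inner ℝ
      ((hasDerivAt_id t).smul h2).hasDerivWithinAt).sub
      ((hasDerivAt_id t).mul_const (inner ℝ ω h)).hasDerivWithinAt
    refine h3.congr_deriv ?_
    simp only [Pi.smul_apply', id, one_smul, inner_add_right, inner_neg_left, real_inner_smul_left,
      real_inner_smul_right]
    ring
  have hzero : ∀ t ∈ Set.Ioo 0 T,
      inner ℝ (p t) (fderiv ℝ X (t • ω) h + t • fderiv ℝ (fderiv ℝ X) (t • ω) ω h)
        - t * (‖p t‖ * inner ℝ (gradient c (X (t • ω))) (fderiv ℝ X (t • ω) h))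
        - inner ℝ ω h = 0 := by
    intro t ht
    have ht' : t ∈ Set.Ico 0 T := Set.Ioo_subset_Ico_self ht
    set z := t • ω with hz
    have hzB : z ∈ Metric.ball 0 T := smul_mem_ball_of_mem_Ico hω ht'
    have hsymm : IsSymmSndFDerivAt ℝ X z := (hX.contDiffAt hzB).isSymmSndFDerivAt (by simp)
    -- the eikonal equation, differentiated at `z` in the direction `h`
    have h1 : HasFDerivAt (fun y => ‖fderiv ℝ X y y‖ ^ 2) _ z :=
      ((hX.hasFDerivAt_fderiv hzB).clm_apply (hasFDerivAt_id z)).norm_sq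
    have h2 : HasFDerivAt (fun y => c (X y) ^ 2 * ‖y‖ ^ 2) _ z :=
      (((hc (X z)).hasGradientAt.hasFDerivAt.comp z (hX.hasFDerivAt hzB)).pow 2).mul
        (hasFDerivAt_id z).norm_sq
    have h3 := h1.unique (h2.congr_of_eventuallyEq
      (by filter_upwards [Metric.isOpen_ball.mem_nhds hzB] with y hy
          using hX.norm_fderiv_self_sq hm hc hpos hy))
    have h4 := DFunLike.congr_fun h3 h
    have hp1 := hX.fderiv_eq_smul_slowness hc hpos hω hp ht'
    have hp2 := hp.speed_mul_norm_slowness hc hpos hω ht'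
    beta_reduce at hp2
    rw [← hz] at hp1 hp2
    have hnz : ‖z‖ = t := by simp [hz, norm_smul, hω, abs_of_pos ht.1]
    have hAz : fderiv ℝ X z z = t • c (X z) ^ 2 • p t := by
      rw [← hp1, ← map_smul]
    have hzh : inner ℝ z h = t * inner ℝ ω h := by rw [hz, real_inner_smul_left]
    have hD : fderiv ℝ (fderiv ℝ X) z h z = t • fderiv ℝ (fderiv ℝ X) z ω h := by
      rw [hsymm h z, hz, map_smul]
      rfl
    simp [hD, hAz, hnz, hzh] at h4
    have hg : inner ℝ (gradient c (X z)) (fderiv ℝ X z h) = fderiv ℝ c (X z) (fderiv ℝ X z h) := by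
      simp
    rw [inner_add_right, real_inner_smul_right, hg]
    have h5 : 2 * t * c (X z) ^ 2 ≠ 0 := by
      have := hpos (X z)
      have := ht.1
      positivity
    refine (mul_eq_zero_iff_left h5).1 ?_
    linear_combination h4 - 2 * t ^ 2 * c (X z) * fderiv ℝ c (X z) (fderiv ℝ X z h) * hp2
  have hsub : Set.Icc 0 ‖y‖ ⊆ Set.Ico 0 T := fun s hs => ⟨hs.1, hs.2.trans_lt hyT.2⟩
  have h1 := eq_of_hasDerivAt_zero hyT.1
    (fun s hs => ((hderiv s (hsub hs)).continuousWithinAt.mono hsub))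
    (fun s hs => by
      rw [← hzero s ⟨hs.1, hs.2.trans hyT.2⟩]
      exact (hderiv s (hsub (Set.Ioo_subset_Icc_self hs))).hasDerivAt
        (Ico_mem_nhds hs.1 (hs.2.trans hyT.2)))
  have h2 := hX.fderiv_eq_smul_slowness hc hpos hω hp hyT
  have h3 : fderiv ℝ X y y = ‖y‖ • c (X y) ^ 2 • p ‖y‖ := by
    rw [← hyω] at h2
    rw [← h2, ← map_smul, ← hyω]
  have h4 : inner ℝ y h = ‖y‖ * inner ℝ ω h := by
    conv_lhs => rw [hyω, real_inner_smul_left]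
  simp only [← hyω, zero_smul, inner_zero_right, zero_mul, sub_zero, real_inner_smul_right] at h1
  rw [h3, h4, real_inner_smul_left, real_inner_smul_left]
  linear_combination c (X y) ^ 2 * h1
end Rays

/-! ### The geodesic polar transformation -/

section Polar
variable {m : ℕ} {c : Space m → ℝ} {x₀ : Space m} {T : ℝ} {X : Space m → Space m}

lemma CausticFree.rayPreimage_map (hX : CausticFree c x₀ T X) {y : Space m}
    (hy : y ∈ Metric.ball 0 T) : rayPreimage X T (X y) = y :=
  hX.injOn.leftInvOn_invFunOn hy

lemma CausticFree.travelTime_map (hX : CausticFree c x₀ T X) {y : Space m}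
    (hy : y ∈ Metric.ball 0 T) : travelTime X T (X y) = ‖y‖ := by
  rw [travelTime, hX.rayPreimage_map hy]

lemma CausticFree.mem_rayNeighbourhood_diff (hX : CausticFree c x₀ T X) (hm : 1 ≤ m) {x : Space m} :
    x ∈ rayNeighbourhood X T \ {x₀} ↔ ∃ y ∈ Metric.ball 0 T, y ≠ 0 ∧ X y = x := by
  have h0 : (0 : Space m) ∈ Metric.ball 0 T := Metric.mem_ball_self hX.time_pos
  constructor
  · rintro ⟨⟨y, hy, rfl⟩, hne⟩
    exact ⟨y, hy, fun h => hne (by rw [h, hX.map_zero hm]; rfl), rfl⟩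
  · rintro ⟨y, hy, hne, rfl⟩
    exact ⟨⟨y, hy, rfl⟩, fun h => hne (hX.injOn hy h0 (h.trans (hX.map_zero hm).symm))⟩

lemma eventually_mem_ball_ne_zero {y : Space m} (hy : y ∈ Metric.ball 0 T) (h0 : y ≠ 0) :
    ∀ᶠ z in 𝓝 y, z ∈ Metric.ball 0 T ∧ z ≠ 0 :=
  (Metric.isOpen_ball.eventually_mem hy).and (isOpen_ne.eventually_mem h0)

/-- The area element of the wavefront is the volume element of the ray map, divided by the length
element `c` along the ray and by that of polar coordinates at the source. -/
lemma CausticFree.wavefrontJacobianAt_map (hX : CausticFree c x₀ T X) (hm : 1 ≤ m)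
    (hc : Differentiable ℝ c) (hpos : ∀ x, 0 < c x) {y : Space m} (hy : y ∈ Metric.ball 0 T)
    (h0 : y ≠ 0) :
    wavefrontJacobianAt X T (X y) = ‖y‖ ^ (m - 1) * |(fderiv ℝ X y).det| / c (X y) := by
  have hny : 0 < ‖y‖ := norm_pos_iff.2 h0
  set ω := ‖y‖⁻¹ • y with hωdef
  have hω : ‖ω‖ = 1 := by simp [hωdef, norm_smul, hny.ne']
  have hyω : ‖y‖ • ω = y := by simp [hωdef, smul_smul, hny.ne']
  have hM : ∀ h, inner ℝ (fderiv ℝ X y ω) (fderiv ℝ X y h) = c (X y) ^ 2 * inner ℝ ω h := by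
    intro h
    rw [hωdef, map_smul, real_inner_smul_left, real_inner_smul_left,
      hX.inner_fderiv_self hm hc hpos hy]
    ring
  have h1 := normDet_eq_norm_mul_normDet_orthogonal (fderiv ℝ X y : Space m →ₗ[ℝ] Space m) hω hM
    (hpos _).le
  rw [LinearMap.normDet_eq_abs_det] at h1
  have h2 : fderiv ℝ (fun z => X (‖y‖ • z)) ω = ‖y‖ • fderiv ℝ X y := by
    have h3 : HasFDerivAt (fun z : Space m => ‖y‖ • z)
        (‖y‖ • ContinuousLinearMap.id ℝ (Space m)) ω :=
      (hasFDerivAt_id ω).fun_const_smul ‖y‖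
    have h4 : HasFDerivAt X (fderiv ℝ X y) (‖y‖ • ω) := by
      rw [hyω]
      exact hX.hasFDerivAt hy
    refine (h4.comp ω h3).fderiv.trans ?_
    ext1 v
    simp
  have h5 : Module.finrank ℝ (Submodule.span ℝ {ω})ᗮ = m - 1 := by
    have h6 := Submodule.finrank_add_finrank_orthogonal (Submodule.span ℝ {ω})
    rw [finrank_span_singleton (by rintro h; simp [h] at hω), finrank_euclideanSpace_fin] at h6
    omega
  have h7 : |(fderiv ℝ X y).det| = c (X y) * ((fderiv ℝ X y : Space m →ₗ[ℝ] Space m) ∘ₗ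
    (Submodule.span ℝ {ω})ᗮ.subtype).normDet := h1
  rw [wavefrontJacobianAt, takeOffAngle, hX.travelTime_map hy, hX.rayPreimage_map hy, ← hωdef,
    wavefrontJacobian, areaFactor_eq_normDet, h2, ContinuousLinearMap.toLinearMap_smul,
    LinearMap.smul_comp, LinearMap.normDet_smul, h5, norm_norm, h7]
  have := (hpos (X y)).ne'
  field_simp

/-- If the derivative at `y` of the pullback of `f` is radial, then by the Gauss lemma the gradient of
`f` at `X y` points along the ray. -/
lemma CausticFree.gradient_of_comp (hX : CausticFree c x₀ T X) (hm : 1 ≤ m)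
    (hc : Differentiable ℝ c) (hpos : ∀ x, 0 < c x) {y : Space m} (hy : y ∈ Metric.ball 0 T)
    {f : Space m → ℝ} {φ : Space m → ℝ} {k : ℝ} (hf : ∀ᶠ z in 𝓝 y, f (X z) = φ z)
    (hφ : HasFDerivAt φ (k • innerSL ℝ y) y) :
    gradient f (X y) = (k / c (X y) ^ 2) • fderiv ℝ X y y := by
  obtain ⟨e, he⟩ := exists_continuousLinearEquiv_of_bijective (hX.regular y hy)
  have hs : HasStrictFDerivAt X (e : Space m →L[ℝ] Space m) y := by
    rw [he]; exact (hX.contDiffAt hy).hasStrictFDerivAt two_ne_zero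
  have h1 := hasFDerivAt_of_comp_localDiffeo hs hf hφ
  refine HasGradientAt.gradient (h1.congr_fderiv ?_)
  ext1 v
  obtain ⟨h, rfl⟩ := e.surjective v
  have h2 : e h = fderiv ℝ X y h := by rw [← he]; rfl
  have := (hpos (X y)).ne'
  rw [InnerProductSpace.toDual_apply_apply, real_inner_smul_left, h2,
    hX.inner_fderiv_self hm hc hpos hy, ← h2]
  simp
  field_simp

lemma CausticFree.gradient_travelTime (hX : CausticFree c x₀ T X) (hm : 1 ≤ m)
    (hc : Differentiable ℝ c) (hpos : ∀ x, 0 < c x) {y : Space m} (hy : y ∈ Metric.ball 0 T)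
    (h0 : y ≠ 0) :
    gradient (travelTime X T) (X y) = (‖y‖⁻¹ / c (X y) ^ 2) • fderiv ℝ X y y := by
  refine hX.gradient_of_comp hm hc hpos hy (φ := fun z => ‖z‖) ?_ ?_
  · filter_upwards [Metric.isOpen_ball.eventually_mem hy] with z hz using hX.travelTime_map hz
  · have h1 := (hasFDerivAt_id y).norm_sq.sqrt (pow_ne_zero 2 (norm_ne_zero_iff.2 h0))
    simp only [id, Real.sqrt_sq (norm_nonneg _)] at h1
    refine h1.congr_fderiv ?_
    ext1 v
    simp
    ring

lemma CausticFree.gradient_travelTime_sq (hX : CausticFree c x₀ T X) (hm : 1 ≤ m)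
    (hc : Differentiable ℝ c) (hpos : ∀ x, 0 < c x) {y : Space m} (hy : y ∈ Metric.ball 0 T) :
    gradient (fun w => travelTime X T w ^ 2) (X y) = (2 / c (X y) ^ 2) • fderiv ℝ X y y := by
  refine hX.gradient_of_comp hm hc hpos hy (φ := fun z => ‖z‖ ^ 2) ?_ ?_
  · filter_upwards [Metric.isOpen_ball.eventually_mem hy] with z hz
    rw [hX.travelTime_map hz]
  · refine (hasFDerivAt_id y).norm_sq.congr_fderiv ?_
    ext1 v
    simp

lemma CausticFree.differentiableAt_det (hX : CausticFree c x₀ T X) {y : Space m}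
    (hy : y ∈ Metric.ball 0 T) : DifferentiableAt ℝ (fun z => (fderiv ℝ X z).det) y :=
  DifferentiableAt.comp y (g := fun A : Space m →L[ℝ] Space m => A.det)
    (differentiable_continuousLinearMap_det _) (hX.hasFDerivAt_fderiv hy).differentiableAt

end Polar

/-! ### The transport equation -/

section Transport
variable {m : ℕ} {ρ ν : Space m → ℝ} {x₀ : Space m} {T : ℝ} {X : Space m → Space m}
  {v₀ : Space m → ℝ}

lemma waveSpeed_pos (hρ_pos : ∀ x, 0 < ρ x) (hν_pos : ∀ x, 0 < ν x) (x : Space m) :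
    0 < waveSpeed ρ ν x :=
  Real.sqrt_pos.2 (div_pos (hν_pos x) (hρ_pos x))

lemma mul_waveSpeed_sq (hρ_pos : ∀ x, 0 < ρ x) (hν_pos : ∀ x, 0 < ν x) (x : Space m) :
    ρ x * waveSpeed ρ ν x ^ 2 = ν x := by
  rw [waveSpeed, Real.sq_sqrt (div_pos (hν_pos x) (hρ_pos x)).le]
  exact mul_div_cancel₀ _ (hρ_pos x).ne'

lemma differentiable_waveSpeed (hρ : Differentiable ℝ ρ) (hν : Differentiable ℝ ν)
    (hρ_pos : ∀ x, 0 < ρ x) (hν_pos : ∀ x, 0 < ν x) : Differentiable ℝ (waveSpeed ρ ν) :=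
  fun x => DifferentiableAt.sqrt
    (by simpa only [div_eq_mul_inv] using (hν x).fun_mul ((hρ x).fun_inv (hρ_pos x).ne'))
    (div_pos (hν_pos x) (hρ_pos x)).ne'

/-- The transport equation in ray coordinates: `2 ρ d ∂v₀ + v₀ ∂(ρ d) = 0`, where `d = det DX` and
`∂` is the derivative along the ray. -/
lemma IsLeadingCoefficient.transport_ray
    (hv₀ : IsLeadingCoefficient ρ ν x₀ (rayNeighbourhood X T) (travelTime X T) v₀)
    (hX : CausticFree (waveSpeed ρ ν) x₀ T X) (hm : 1 ≤ m)
    (hρ : Differentiable ℝ ρ) (hν : Differentiable ℝ ν)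
    (hρ_pos : ∀ x, 0 < ρ x) (hν_pos : ∀ x, 0 < ν x)
    {y : Space m} (hy : y ∈ Metric.ball 0 T) (h0 : y ≠ 0) :
    2 * ρ (X y) * (fderiv ℝ X y).det * fderiv ℝ v₀ (X y) (fderiv ℝ X y y)
      + (fderiv ℝ ρ (X y) (fderiv ℝ X y y) * (fderiv ℝ X y).det
        + ρ (X y) * fderiv ℝ (fun z => (fderiv ℝ X z).det) y y) * v₀ (X y) = 0 := by
  have hc := differentiable_waveSpeed hρ hν hρ_pos hν_pos
  have hpos := waveSpeed_pos hρ_pos hν_pos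
  have hν' := mul_waveSpeed_sq hρ_pos hν_pos
  have htr := hv₀.transport (X y) ((hX.mem_rayNeighbourhood_diff hm).2 ⟨y, hy, h0, rfl⟩)
  have hφ : HasFDerivAt (fun z => 2 * ρ (X z))
      ((2 : ℝ) • (fderiv ℝ ρ (X y)).comp (fderiv ℝ X y)) y :=
    ((hρ (X y)).hasFDerivAt.comp y (hX.hasFDerivAt hy)).const_mul 2
  have hdiv := (divergence_pushforward_radial (φ := fun z => 2 * ρ (X z))
    (G := fun z => ν z • gradient (fun w => travelTime X T w ^ 2) z) (hX.contDiffAt hy)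
    (hX.regular y hy) hφ.differentiableAt (by
      filter_upwards [Metric.isOpen_ball.eventually_mem hy] with z hz
      have := (hpos (X z)).ne'
      rw [hX.gradient_travelTime_sq hm hc hpos hz, smul_smul, ← hν']
      congr 1
      field_simp)).2
  rw [hφ.fderiv] at hdiv
  have hgrad : 4 * ν (X y) * ‖y‖ * inner ℝ (gradient (travelTime X T) (X y)) (gradient v₀ (X y))
      = 4 * ρ (X y) * fderiv ℝ v₀ (X y) (fderiv ℝ X y y) := by
    have h1 := (hpos (X y)).ne'
    have h2 := norm_ne_zero_iff.2 h0
    have h3 : inner ℝ (fderiv ℝ X y y) (gradient v₀ (X y)) =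
      fderiv ℝ v₀ (X y) (fderiv ℝ X y y) := by simp
    rw [hX.gradient_travelTime hm hc hpos hy h0, real_inner_smul_left, ← hν', h3]
    field_simp
  rw [hX.travelTime_map hy, hgrad] at htr
  simp only [smul_apply, ContinuousLinearMap.comp_apply, smul_eq_mul] at hdiv
  linear_combination (1 / 2) * (fderiv ℝ X y).det * htr - (1 / 2) * v₀ (X y) * hdiv

/-- The conservation law behind the transport equation: `ρ v₀² det DX` is constant along rays. -/
lemma IsLeadingCoefficient.mul_det_mul_sq
    (hv₀ : IsLeadingCoefficient ρ ν x₀ (rayNeighbourhood X T) (travelTime X T) v₀)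
    (hX : CausticFree (waveSpeed ρ ν) x₀ T X) (hm : 1 ≤ m)
    (hρ : Differentiable ℝ ρ) (hν : Differentiable ℝ ν)
    (hρ_pos : ∀ x, 0 < ρ x) (hν_pos : ∀ x, 0 < ν x)
    {y : Space m} (hy : y ∈ Metric.ball 0 T) :
    ρ (X y) * (fderiv ℝ X y).det * v₀ (X y) ^ 2 = ρ x₀ * waveSpeed ρ ν x₀ ^ m * v₀ x₀ ^ 2 := by
  have hcentre : ρ (X 0) * (fderiv ℝ X 0).det * v₀ (X 0) ^ 2 =
      ρ x₀ * waveSpeed ρ ν x₀ ^ m * v₀ x₀ ^ 2 := by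
    rw [hX.map_zero hm, hX.fderiv_zero hm (differentiable_waveSpeed hρ hν hρ_pos hν_pos)
      (waveSpeed_pos hρ_pos hν_pos)]
    simp [ContinuousLinearMap.det]
  rcases eq_or_ne y 0 with rfl | h0
  · exact hcentre
  -- `v₀` is only continuous at the source, so the derivative is taken on `(0, 1]`
  set f : ℝ → ℝ := fun s => ρ (X (s • y)) * (fderiv ℝ X (s • y)).det * v₀ (X (s • y)) ^ 2 with hf
  have hball : ∀ s ∈ Set.Icc (0 : ℝ) 1, s • y ∈ Metric.ball (0 : Space m) T := by
    intro s hs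
    rw [mem_ball_zero_iff] at hy ⊢
    rw [norm_smul, Real.norm_eq_abs, abs_of_nonneg hs.1]
    exact (mul_le_of_le_one_left (norm_nonneg y) hs.2).trans_lt hy
  have hline : ∀ s : ℝ, HasDerivAt (fun s : ℝ => s • y) y s := fun s => by
    simpa using (hasDerivAt_id s).smul_const y
  have hderiv : ∀ s ∈ Set.Ioc (0 : ℝ) 1, HasDerivAt f 0 s := by
    intro s hs
    have hs' := hball s (Set.Ioc_subset_Icc_self hs)
    have hs0 : s • y ≠ 0 := smul_ne_zero hs.1.ne' h0
    have hXs : HasDerivAt (fun s : ℝ => X (s • y)) _ s :=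
      (hX.hasFDerivAt hs').comp_hasDerivAt s (hline s)
    have hd : HasDerivAt (fun s : ℝ => (fderiv ℝ X (s • y)).det) _ s :=
      HasFDerivAt.comp_hasDerivAt s (l := fun z => (fderiv ℝ X z).det)
        (hX.differentiableAt_det hs').hasFDerivAt (hline s)
    have hv : HasDerivAt (fun s : ℝ => v₀ (X (s • y))) _ s :=
      (hv₀.differentiableAt _ ((hX.mem_rayNeighbourhood_diff hm).2
        ⟨_, hs', hs0, rfl⟩)).hasFDerivAt.comp_hasDerivAt s hXs
    have hr : HasDerivAt (fun s : ℝ => ρ (X (s • y))) _ s :=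
      (hρ _).hasFDerivAt.comp_hasDerivAt s hXs
    refine ((hr.mul hd).mul (hv.pow 2)).congr_deriv ?_
    have h1 := hv₀.transport_ray hX hm hρ hν hρ_pos hν_pos hs' hs0
    simp only [map_smul, smul_eq_mul] at h1
    have h2 : s ≠ 0 := hs.1.ne'
    -- `transport_ray` at `s • y` differentiates in the direction `s • y` instead of `y`
    refine (mul_eq_zero_iff_left h2).1 ?_
    simp only [Pi.mul_apply, Pi.pow_apply]
    push_cast
    linear_combination v₀ (X (s • y)) * h1
  have hcont : ContinuousOn f (Set.Icc 0 1) := by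
    intro s hs
    rcases hs.1.eq_or_lt with rfl | hs0
    · have hb := hball 0 hs
      have hXc : ContinuousAt (fun s : ℝ => X (s • y)) 0 :=
        ((hX.hasFDerivAt hb).comp_hasDerivAt 0 (hline 0)).continuousAt
      have hd : ContinuousAt (fun s : ℝ => (fderiv ℝ X (s • y)).det) 0 :=
        (HasFDerivAt.comp_hasDerivAt 0 (l := fun z => (fderiv ℝ X z).det)
          (hX.differentiableAt_det hb).hasFDerivAt (hline 0)).continuousAt
      have hv : ContinuousAt (fun s : ℝ => v₀ (X (s • y))) 0 := by
        refine ContinuousAt.comp (g := v₀) ?_ hXc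
        rw [zero_smul, hX.map_zero hm]
        exact hv₀.continuousAt
      have hr : ContinuousAt (fun s : ℝ => ρ (X (s • y))) 0 :=
        ContinuousAt.comp (g := ρ) (hρ _).continuousAt hXc
      exact ((hr.mul hd).mul (hv.pow 2)).continuousWithinAt
    · exact (hderiv s ⟨hs0, hs.2⟩).continuousAt.continuousWithinAt
  have h1 := eq_of_hasDerivAt_zero zero_le_one hcont
    (fun s hs => hderiv s (Set.Ioo_subset_Ioc_self hs))
  simp only [hf, one_smul, zero_smul] at h1
  rw [h1, hcentre]

/-- The constant value of `ρ v₀² det DX` along the rays, from the normalization of `v₀` at the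
source. -/
lemma IsLeadingCoefficient.four_mul_mul_det_mul_sq
    (hv₀ : IsLeadingCoefficient ρ ν x₀ (rayNeighbourhood X T) (travelTime X T) v₀)
    (hX : CausticFree (waveSpeed ρ ν) x₀ T X) (hm : 1 ≤ m)
    (hρ : Differentiable ℝ ρ) (hν : Differentiable ℝ ν)
    (hρ_pos : ∀ x, 0 < ρ x) (hν_pos : ∀ x, 0 < ν x)
    {y : Space m} (hy : y ∈ Metric.ball 0 T) :
    4 * ρ x₀ * waveSpeed ρ ν x₀ ^ m * Real.pi ^ (m - 1) *
      (ρ (X y) * (fderiv ℝ X y).det * v₀ (X y) ^ 2) = 1 := by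
  have hπ : (Real.pi ^ (((m : ℝ) - 1) / 2)) ^ 2 = Real.pi ^ (m - 1) := by
    rw [← Real.rpow_natCast, ← Real.rpow_mul Real.pi_pos.le, ← Real.rpow_natCast]
    congr 1
    push_cast [hm]
    ring
  have h1 := hρ_pos x₀
  have h2 := waveSpeed_pos hρ_pos hν_pos x₀
  have h3 : 0 < Real.pi ^ (((m : ℝ) - 1) / 2) := Real.rpow_pos_of_pos Real.pi_pos _
  rw [hv₀.mul_det_mul_sq hX hm hρ hν hρ_pos hν_pos hy, hv₀.source_value, ← hπ]
  field_simp
  norm_num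

end Transport

/-! ### The divergence-free field -/

section Divergence
variable {m : ℕ} {c : Space m → ℝ} {x₀ : Space m} {T : ℝ} {X : Space m → Space m}

/-- The field `c J⁻¹ ∇τ` is the Piola transform of `y ↦ ‖y‖⁻ᵐ y`, which is free of divergence. -/
lemma CausticFree.divergence_eq_zero (hX : CausticFree c x₀ T X) (hm : 1 ≤ m)
    (hc : Differentiable ℝ c) (hpos : ∀ x, 0 < c x)
    (hdet : ∀ z ∈ Metric.ball 0 T, 0 < (fderiv ℝ X z).det) {y : Space m}
    (hy : y ∈ Metric.ball 0 T) (h0 : y ≠ 0) :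
    DifferentiableAt ℝ
      (fun z => (c z * (wavefrontJacobianAt X T z)⁻¹) • gradient (travelTime X T) z) (X y) ∧
    divergence (fun z => (c z * (wavefrontJacobianAt X T z)⁻¹) • gradient (travelTime X T) z)
      (X y) = 0 := by
  have hn : ‖y‖ ≠ 0 := norm_ne_zero_iff.2 h0
  have hd := (hdet y hy).ne'
  have hnd : DifferentiableAt ℝ (fun z : Space m => ‖z‖) y := differentiableAt_id.norm ℝ h0
  have hdd := hX.differentiableAt_det hy
  have hP : HasFDerivAt (fun z : Space m => ‖z‖ ^ m * (fderiv ℝ X z).det) _ y :=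
    (hnd.hasFDerivAt.pow m).mul hdd.hasFDerivAt
  have hP0 : ‖y‖ ^ m * (fderiv ℝ X y).det ≠ 0 := mul_ne_zero (pow_ne_zero _ hn) hd
  have hφ : HasFDerivAt (fun z : Space m => (‖z‖ ^ m * (fderiv ℝ X z).det)⁻¹) _ y :=
    (hasDerivAt_inv hP0).comp_hasFDerivAt y hP
  obtain ⟨h1, h2⟩ := divergence_pushforward_radial
    (G := fun z => (c z * (wavefrontJacobianAt X T z)⁻¹) • gradient (travelTime X T) z)
    (hX.contDiffAt hy) (hX.regular y hy) hφ.differentiableAt (by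
      filter_upwards [eventually_mem_ball_ne_zero hy h0] with z ⟨hz, hz0⟩
      have h3 := (hpos (X z)).ne'
      have h4 := norm_ne_zero_iff.2 hz0
      have h5 := (hdet z hz).ne'
      rw [hX.wavefrontJacobianAt_map hm hc hpos hz hz0, hX.gradient_travelTime hm hc hpos hz hz0,
        smul_smul, abs_of_pos (hdet z hz), ← mul_pow_sub_one (by omega : m ≠ 0) ‖z‖]
      congr 1
      field_simp)
  refine ⟨h1, (mul_eq_zero_iff_left hd).1 ?_⟩
  have hny : fderiv ℝ (fun z : Space m => ‖z‖) y y = ‖y‖ := hnd.fderiv_norm_self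
  rw [h2, hφ.fderiv]
  obtain ⟨k, rfl⟩ : ∃ k, m = k + 1 := ⟨m - 1, by omega⟩
  simp [hny]
  field_simp
  ring

end Divergence

end Hadamard

theorem mainTheorem2 (m : ℕ) (hm : 1 ≤ m) (ρ ν : Hadamard.Space m → ℝ)
    (hρ : ContDiff ℝ (⊤ : ℕ∞) ρ) (hν : ContDiff ℝ (⊤ : ℕ∞) ν)
    (hρ_pos : ∀ x, 0 < ρ x) (hν_pos : ∀ x, 0 < ν x)
    (x₀ : Hadamard.Space m) (T : ℝ) (X : Hadamard.Space m → Hadamard.Space m)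
    (hX : Hadamard.CausticFree (Hadamard.waveSpeed ρ ν) x₀ T X)
    (v₀ : Hadamard.Space m → ℝ)
    (hv₀ : Hadamard.IsLeadingCoefficient ρ ν x₀ (Hadamard.rayNeighbourhood X T)
      (Hadamard.travelTime X T) v₀) :
    ∀ x ∈ Hadamard.rayNeighbourhood X T \ {x₀},
      v₀ x ≠ 0 ∧
      Hadamard.wavefrontJacobianAt X T x =
        Hadamard.travelTime X T x ^ (m - 1) /
          (4 * ρ x₀ * Hadamard.waveSpeed ρ ν x₀ ^ m * Real.pi ^ (m - 1)
            * ρ x * Hadamard.waveSpeed ρ ν x * v₀ x ^ 2) ∧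
      DifferentiableAt ℝ (fun z => (Hadamard.waveSpeed ρ ν z
        * (Hadamard.wavefrontJacobianAt X T z)⁻¹) • gradient (Hadamard.travelTime X T) z) x ∧
      Hadamard.divergence (fun z => (Hadamard.waveSpeed ρ ν z
        * (Hadamard.wavefrontJacobianAt X T z)⁻¹) • gradient (Hadamard.travelTime X T) z) x = 0 := by
  have hρ' := hρ.differentiable (by simp)
  have hν' := hν.differentiable (by simp)
  have hc := Hadamard.differentiable_waveSpeed hρ' hν' hρ_pos hν_pos
  have hpos := Hadamard.waveSpeed_pos hρ_pos hν_pos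
  have hinv {y : Hadamard.Space m} (hy : y ∈ Metric.ball 0 T) :=
    hv₀.four_mul_mul_det_mul_sq hX hm hρ' hν' hρ_pos hν_pos hy
  -- the conserved quantity `ρ v₀² det DX` is positive, which fixes the sign of `det DX`
  have hdet : ∀ y ∈ Metric.ball (0 : Hadamard.Space m) T, 0 < (fderiv ℝ X y).det := by
    intro y hy
    by_contra! hneg
    have h1 := hinv hy
    have h2 : 0 ≤ 4 * ρ x₀ * Hadamard.waveSpeed ρ ν x₀ ^ m * Real.pi ^ (m - 1) := by
      have := hρ_pos x₀
      have := hpos x₀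
      positivity
    have h3 : ρ (X y) * (fderiv ℝ X y).det * v₀ (X y) ^ 2 ≤ 0 :=
      mul_nonpos_of_nonpos_of_nonneg (mul_nonpos_of_nonneg_of_nonpos (hρ_pos _).le hneg)
        (sq_nonneg _)
    linarith [mul_nonpos_of_nonneg_of_nonpos h2 h3]
  intro x hx
  obtain ⟨y, hy, h0, rfl⟩ := (hX.mem_rayNeighbourhood_diff hm).1 hx
  have hv : v₀ (X y) ≠ 0 := by
    intro h
    have h1 := hinv hy
    simp [h] at h1
  refine ⟨hv, ?_, hX.divergence_eq_zero hm hc hpos hdet hy h0⟩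
  have h1 := hρ_pos x₀
  have h2 := hpos x₀
  have h3 := hρ_pos (X y)
  have h4 := hpos (X y)
  rw [hX.wavefrontJacobianAt_map hm hc hpos hy h0, hX.travelTime_map hy, abs_of_pos (hdet y hy),
    div_eq_div_iff h4.ne' (by positivity)]
  linear_combination ‖y‖ ^ (m - 1) * Hadamard.waveSpeed ρ ν (X y) * hinv hy
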